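/- **Setting.** One item is sold to $n\ge 1$ bidders whose values $v_1,\dots,v_n\ge 0$ are independent, $v_i\sim F_i$. Each $F_i$ is *regular*: it is a probability distribution on $[0,\infty)$ with a density $f_i$ that is positive on $\{v: 0<F_i(v)<1\}$ and whose virtual value $v-\frac{1-F_i(v)}{f_i(v)}$ is nondecreasing on that set. The $F_i$ need not be identical, but for each bidder $i$ there is a bidder $j\neq i$ with $F_j=F_i$. An *auction* consists of (measurable) allocation rules $x_i:\mathbb R_+^n\to[0,1]$ with $\sum_i x_i(v)\le 1$ and payment rules $p_i:\mathbb R_+^n\to\mathbb R$. It is *individually rational* if $v_i x_i(v)-p_i(v)\ge 0$ for all $i$ and all $v$. It is *dominant strategy incentive compatible* if $v_i x_i(v)-p_i(v)\ge v_i x_i(b,v_{-i})-p_i(b,v_{-i})$ for all $i$, $v$ and $b\ge 0$, and *Bayesian incentive compatible* for $(F_1,\dots,F_n)$ if the same inequality holds in expectation over $v_{-i}\sim\prod_{j\ne i}F_j$, for every $i$, every value $v_i\ge 0$ and every $b\ge 0$. Its revenue is $\mathbb E[\sum_i p_i(v)]$. Let $\mathrm{OPT}(F_1,\dots,F_n)$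 be the supremum of the revenues of all individually rational auctions that are Bayesian incentive compatible for $(F_1,\dots,F_n)$ and whose payments have finite expectations; such auctions may depend on $F_1,\dots,F_n$. **Statement.** There is an absolute constant $\alpha>\tfrac18$ such that for every $n\ge 1$ there is an individually rational, dominant strategy incentive compatible auction $A$ for $n$ bidders, not depending on the distributions (prior-independent), such that for all $F_1,\dots,F_n$ as above the payments of $A$ have finite expectations, $\mathrm{OPT}(F_1,\dots,F_n)<\infty$, and $$\mathrm{Rev}(A)\ \ge\ \alpha\cdot \mathrm{OPT}(F_1,\dots,F_n),\qquad \mathrm{Rev}(A)\ >\ \tfrac18\,\mathrm{OPT}(F_1,\dots,F_n).$$ -/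

import Mathlib

open MeasureTheory

/-- A (direct) single-item auction with `n` bidders.  On a profile `v` of nonnegative bids, bidder
`i` receives the item with probability `alloc v i` and makes the payment `pay v i`.  Only
nonnegative profiles are meaningful; the rules are functions on all of `ℝⁿ` for convenience. -/
structure Auction (n : ℕ) where
  /-- allocation rules -/
  alloc : (Fin n → ℝ) → Fin n → ℝ
  /-- payment rules -/
  pay : (Fin n → ℝ) → Fin n → ℝ
  measurable_alloc : ∀ i, Measurable fun v => alloc v i
  measurable_pay : ∀ i, Measurable fun v => pay v i
  alloc_nonneg : ∀ v, (∀ j, 0 ≤ v j) → ∀ i, 0 ≤ alloc v i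
  alloc_sum_le_one : ∀ v, (∀ j, 0 ≤ v j) → ∑ i, alloc v i ≤ 1

namespace Auction

variable {n : ℕ}

/-- Individual rationality: on every bid profile the utility of every bidder is nonnegative. -/
def IsIndividuallyRational (A : Auction n) : Prop :=
  ∀ v : Fin n → ℝ, (∀ j, 0 ≤ v j) → ∀ i, 0 ≤ A.alloc v i * v i - A.pay v i

/-- Dominant strategy incentive compatibility: whatever the others bid, bidding one's true
value `v i` is at least as good as any other bid `b`. -/
def IsDominantStrategyIC (A : Auction n) : Prop :=
  ∀ v : Fin n → ℝ, (∀ j, 0 ≤ v j) → ∀ (i : Fin n) (b : ℝ), 0 ≤ b →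
    A.alloc (Function.update v i b) i * v i - A.pay (Function.update v i b) i
      ≤ A.alloc v i * v i - A.pay v i

/-- The interim allocation rule: the expected probability with which bidder `i` wins when bidding
`b`, the other bids being drawn independently from `μ j`, `j ≠ i`.  (The coordinate `i` of `w` is
overwritten by `b`, so that the expectation is over the other bids only.) -/
noncomputable def interimAlloc (A : Auction n) (μ : Fin n → Measure ℝ) (i : Fin n) (b : ℝ) : ℝ :=
  ∫ w, A.alloc (Function.update w i b) i ∂(Measure.pi μ)

/-- The interim payment rule. -/
noncomputable def interimPay (A : Auction n) (μ : Fin n → Measure ℝ) (i : Fin n) (b : ℝ) : ℝ :=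
  ∫ w, A.pay (Function.update w i b) i ∂(Measure.pi μ)

/-- Bayesian incentive compatibility with respect to the prior `μ`: interim payments are
well defined, and the interim expected utility is maximized by bidding the true value. -/
def IsBayesianIC (A : Auction n) (μ : Fin n → Measure ℝ) : Prop :=
  (∀ (i : Fin n) (b : ℝ), 0 ≤ b →
    Integrable (fun w => A.pay (Function.update w i b) i) (Measure.pi μ)) ∧
  ∀ (i : Fin n) (t b : ℝ), 0 ≤ t → 0 ≤ b →
    A.interimAlloc μ i b * t - A.interimPay μ i b ≤ A.interimAlloc μ i t * t - A.interimPay μ i t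

/-- All payments have an expectation when the values are independent with laws `μ i`. -/
def HasExpectedPayments (A : Auction n) (μ : Fin n → Measure ℝ) : Prop :=
  ∀ i, Integrable (fun v => A.pay v i) (Measure.pi μ)

/-- Expected revenue of the auction when the values are independent with laws `μ i`. -/
noncomputable def revenue (A : Auction n) (μ : Fin n → Measure ℝ) : ℝ :=
  ∫ v, ∑ i, A.pay v i ∂(Measure.pi μ)

end Auction

/-- The expected revenues of all individually rational auctions that are Bayesian incentive
compatible for the prior `μ` (the auction may depend on `μ`). -/
def attainableRevenues {n : ℕ} (μ : Fin n → Measure ℝ) : Set ℝ :=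
  {r | ∃ B : Auction n, B.IsIndividuallyRational ∧ B.IsBayesianIC μ ∧ B.HasExpectedPayments μ ∧
    r = B.revenue μ}

/-- The optimal revenue for the known prior `μ`. -/
noncomputable def optimalRevenue {n : ℕ} (μ : Fin n → Measure ℝ) : ℝ :=
  sSup (attainableRevenues μ)

/-- The virtual value `v - (1 - F v) / f v` of a distribution with c.d.f. `F` and density `f`. -/
noncomputable def virtualValue (μ : Measure ℝ) (f : ℝ → ℝ) (v : ℝ) : ℝ :=
  v - (1 - ProbabilityTheory.cdf μ v) / f v

/-- A regular value distribution: a probability distribution on `[0, ∞)` with a density `f` that is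
positive wherever `0 < F < 1` (there the virtual value makes sense) and for which the virtual value
is nondecreasing there.  The set `0 < F < 1` is the interior of the convex hull of the support. -/
def IsRegularDistribution (μ : Measure ℝ) : Prop :=
  IsProbabilityMeasure μ ∧ μ (Set.Iio 0) = 0 ∧
  ∃ f : ℝ → ℝ, Measurable f ∧ (∀ v, 0 ≤ f v) ∧
    μ = volume.withDensity (fun v => ENNReal.ofReal (f v)) ∧
    (∀ v, 0 < ProbabilityTheory.cdf μ v → ProbabilityTheory.cdf μ v < 1 → 0 < f v) ∧
    MonotoneOn (virtualValue μ f)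
      {v | 0 < ProbabilityTheory.cdf μ v ∧ ProbabilityTheory.cdf μ v < 1}

/-!
The auction is the second price auction, and `α = 2 / 15`.

For a threshold `τ > 0` let `wᵢ` be the largest revenue from bidder `i` alone at a posted price of
at least `τ` (`postedPriceRevenue`), and let `W = ∑ wᵢ`.

*Upper bound*: `OPT ≤ τ + W` (`Auction.revenue_le`). To each bidder, an incentive compatible
auction looks like a mixture of posted prices. Those below `τ` bring at most `τ` per unit of sale
probability, and the sale probabilities add up to at most one; those above `τ` bring at most `wᵢ`
(`integral_payment_le`).

*Lower bound*: the second price auction earns at least `W τ / (W + 3 τ)`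
(`SecondPrice.le_revenue`). Regularity means that the revenue as a function of the sale probability
is concave, which bounds the probability that `vᵢ ≥ t` from below by `wᵢ / (wᵢ + t)` for all
`t ≤ τ` (`IsRegularDistribution.tail_bound`). Because every bidder has a twin, the bidders can be
divided into two parts of total weight at least `S = W / 3` each (`exists_third_le_sum`). In either
part some bid is at least `t` with probability at least `S / (S + t)` (`prod_mul_add_sum_le`), and
the two parts are independent. Hence the second highest bid is at least `t` with probability at
least `(S / (S + t))²`, and the integral of this over `0 < t ≤ τ` is `S τ / (S + τ)`.

With `τ = OPT / 3` the upper bound gives `W ≥ 2 OPT / 3`, and the lower bound is then at least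
`2 OPT / 15`. The revenue is positive since `W > 0` for small `τ`, which makes the second inequality
strict also where `OPT` is not known to be positive.
-/

/-! ### Monotonicity up to second-order errors -/

/-- A function whose decrease over every subinterval `[a, b]` is at most `(b - a) (m b - m a)`, an
error of second order, does not decrease at all: over `N` equal pieces the errors add up to
`(r - l) (m r - m l) / N`. -/
lemma le_of_forall_sub_le_mul_sub {D m : ℝ → ℝ} {l r : ℝ} (hlr : l ≤ r)
    (h : ∀ a b, l ≤ a → a ≤ b → b ≤ r → D a - D b ≤ (b - a) * (m b - m a)) : D l ≤ D r := by
  have key : ∀ N : ℕ, D l - D r ≤ ((r - l) * (m r - m l)) / ((N : ℝ) + 1) := by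
    intro N
    have hN : (0 : ℝ) < (N : ℝ) + 1 := by positivity
    set δ := (r - l) / ((N : ℝ) + 1) with hδ
    have hδ0 : 0 ≤ δ := div_nonneg (by linarith) hN.le
    have hr : l + ((N + 1 : ℕ) : ℝ) * δ = r := by
      rw [hδ]; push_cast; field_simp; ring
    have hsum : ∀ k : ℕ, k ≤ N + 1 → D l - D (l + k * δ) ≤ δ * (m (l + k * δ) - m l) := by
      intro k
      induction k with
      | zero => intro _; simp
      | succ k ih =>
        intro hk
        have h1 := ih (by omega)
        have h2 := h (l + k * δ) (l + (k + 1 : ℕ) * δ)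
          (by have : 0 ≤ (k : ℝ) * δ := by positivity
              linarith)
          (by push_cast; linarith)
          (by rw [← hr]
              have : ((k + 1 : ℕ) : ℝ) ≤ ((N + 1 : ℕ) : ℝ) := by exact_mod_cast hk
              have := mul_le_mul_of_nonneg_right this hδ0
              linarith)
        have h3 : l + (k + 1 : ℕ) * δ - (l + k * δ) = δ := by push_cast; ring
        rw [h3] at h2
        linarith
    have h4 := hsum (N + 1) le_rfl
    rw [hr, hδ] at h4
    calc D l - D r ≤ _ := h4
      _ = _ := by ring
  by_contra! hlt
  obtain ⟨N, hN⟩ := exists_nat_gt (((r - l) * (m r - m l)) / (D l - D r))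
  have h5 := key N
  have hpos : 0 < D l - D r := by linarith
  rw [div_lt_iff₀ hpos] at hN
  rw [le_div_iff₀ (by positivity)] at h5
  nlinarith

/-! ### Revenue curves of regular distributions -/

namespace IsRegularDistribution

variable {μ : Measure ℝ}

lemma nullSingletonClass (h : IsRegularDistribution μ) : NullSingletonClass μ := by
  obtain ⟨-, -, f, -, -, hμ, -⟩ := h
  rw [hμ]
  exact ⟨fun x => withDensity_absolutelyContinuous _ _ (measure_singleton x)⟩

lemma cdf_eq_one_sub (h : IsRegularDistribution μ) (t : ℝ) :
    ProbabilityTheory.cdf μ t = 1 - μ.real (Set.Ici t) := by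
  have := h.1
  have := h.nullSingletonClass
  rw [ProbabilityTheory.cdf_eq_real, measureReal_congr (Iio_ae_eq_Iic (a := t)).symm,
    ← Set.compl_Ici, probReal_compl_eq_one_sub measurableSet_Ici]

lemma continuous_cdf (h : IsRegularDistribution μ) : Continuous (ProbabilityTheory.cdf μ) := by
  have := h.1
  have := h.nullSingletonClass
  rw [continuous_iff_continuousAt]
  intro x
  rw [(ProbabilityTheory.monotone_cdf μ).continuousAt_iff_leftLim_eq_rightLim,
    (ProbabilityTheory.cdf μ).rightLim_eq]
  have h1 := (ProbabilityTheory.cdf μ).measure_singleton x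
  rw [ProbabilityTheory.measure_cdf, measure_singleton, eq_comm, ENNReal.ofReal_eq_zero] at h1
  refine le_antisymm ((ProbabilityTheory.monotone_cdf μ).leftLim_le le_rfl) (by linarith)

lemma cdf_zero (h : IsRegularDistribution μ) : ProbabilityTheory.cdf μ 0 = 0 := by
  have := h.1
  have := h.nullSingletonClass
  rw [ProbabilityTheory.cdf_eq_real, measureReal_congr (Iio_ae_eq_Iic (a := (0 : ℝ))).symm,
    Measure.real, h.2.1, ENNReal.toReal_zero]

/-- Where the tangent to the revenue curve at the price `t` has slope `c = φ(t)`, the revenue from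
the price `v`, less `c` times the probability of sale, is largest at `v = t`. -/
lemma exists_forall_sub_mul_le (h : IsRegularDistribution μ) {t : ℝ}
    (ht0 : 0 < ProbabilityTheory.cdf μ t) (ht1 : ProbabilityTheory.cdf μ t < 1) :
    ∃ c : ℝ, ∀ v, 0 < ProbabilityTheory.cdf μ v → ProbabilityTheory.cdf μ v < 1 →
      (v - c) * (1 - ProbabilityTheory.cdf μ v) ≤ (t - c) * (1 - ProbabilityTheory.cdf μ t) := by
  have := h.1
  obtain ⟨-, -, f, hfm, hf0, hμ, hfpos, hmono⟩ := h
  set F := ProbabilityTheory.cdf μ with hF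
  have hFm : Monotone F := ProbabilityTheory.monotone_cdf μ
  have hfi : Integrable f := by
    refine ⟨hfm.aestronglyMeasurable, ?_⟩
    rw [hasFiniteIntegral_iff_ofReal (ae_of_all _ hf0)]
    have h1 : μ Set.univ = 1 := measure_univ
    rw [hμ, withDensity_apply _ MeasurableSet.univ, setLIntegral_univ] at h1
    rw [h1]; exact ENNReal.one_lt_top
  have hFsub : ∀ a b, a ≤ b → F b - F a = ∫ s in Set.Ioc a b, f s := by
    intro a b hab
    rw [hF, ProbabilityTheory.cdf_eq_real, ProbabilityTheory.cdf_eq_real,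
      ← measureReal_sdiff (Set.Iic_subset_Iic.2 hab) measurableSet_Iic, Set.Iic_sdiff_Iic,
      integral_eq_lintegral_of_nonneg_ae (ae_of_all _ hf0) hfm.aestronglyMeasurable,
      ← withDensity_apply _ measurableSet_Ioc, ← hμ]
    rfl
  have hle : ∀ a b k K, a ≤ b → (∀ s ∈ Set.Ioc a b, f s * k ≤ K) →
      (F b - F a) * k ≤ K * (b - a) := by
    intro a b k K hab hs
    rw [hFsub a b hab, ← integral_mul_const]
    have h1 : ∫ _ in Set.Ioc a b, K = K * (b - a) := by
      rw [setIntegral_const, Measure.real, Real.volume_Ioc,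
        ENNReal.toReal_ofReal (by linarith), smul_eq_mul, mul_comm]
    rw [← h1]
    exact setIntegral_mono_on (hfi.mul_const k).integrableOn (integrable_const _)
      measurableSet_Ioc hs
  set c := virtualValue μ f t with hc
  refine ⟨c, fun v hv0 hv1 => ?_⟩
  have hvirt : ∀ s, 0 < F s → F s < 1 → f s * (s - virtualValue μ f s) = 1 - F s := by
    intro s h0 h1
    have := hfpos s h0 h1
    rw [virtualValue, ← hF]
    field_simp
    ring
  rcases le_total v t with hvt | htv
  · refine le_of_forall_sub_le_mul_sub (D := fun v => (v - c) * (1 - F v)) (m := F) hvt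
      fun a b hva hab hbt => ?_
    have := hle a b (a - c) (1 - F a) hab fun s hs => by
      have hs0 : 0 < F s := hv0.trans_le (hFm (hva.trans hs.1.le))
      have hs1 : F s < 1 := (hFm (hs.2.trans hbt)).trans_lt ht1
      have hφ : virtualValue μ f s ≤ c := hmono ⟨hs0, hs1⟩ ⟨ht0, ht1⟩ (hs.2.trans hbt)
      have h1 := mul_le_mul_of_nonneg_left
        (show a - c ≤ s - virtualValue μ f s by linarith [hs.1]) (hf0 s)
      have h2 := hFm hs.1.le
      linarith [hvirt s hs0 hs1]
    linarith
  · have := le_of_forall_sub_le_mul_sub (D := fun v => -((v - c) * (1 - F v))) (m := F) htv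
      fun a b hta hab hbv => by
        have := hle a b (c - b) (-(1 - F b)) hab fun s hs => by
          have hs0 : 0 < F s := ht0.trans_le (hFm (hta.trans hs.1.le))
          have hs1 : F s < 1 := (hFm (hs.2.trans hbv)).trans_lt hv1
          have hφ : c ≤ virtualValue μ f s := hmono ⟨ht0, ht1⟩ ⟨hs0, hs1⟩ (hta.trans hs.1.le)
          have h1 := mul_le_mul_of_nonneg_left
            (show s - virtualValue μ f s ≤ b - c by linarith [hs.2]) (hf0 s)
          have h2 := hFm hs.2
          linarith [hvirt s hs0 hs1]
        linarith
    linarith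

/-- The chord inequality for the concave revenue curve.  In terms of `G t = μ [t, ∞)` it says that
`t G(t) / (1 - G(t))` is nonincreasing. -/
lemma mul_tail_mul_le (h : IsRegularDistribution μ) {t p : ℝ} (ht : 0 < t) (htp : t ≤ p) :
    p * μ.real (Set.Ici p) * (1 - μ.real (Set.Ici t)) ≤
      t * μ.real (Set.Ici t) * (1 - μ.real (Set.Ici p)) := by
  have hprob := h.1
  set F := ProbabilityTheory.cdf μ with hF
  have hFm : Monotone F := ProbabilityTheory.monotone_cdf μ
  have hG : ∀ s, μ.real (Set.Ici s) = 1 - F s := fun s => by rw [hF, h.cdf_eq_one_sub]; ring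
  rw [hG, hG]
  have h0 : ∀ s, 0 ≤ F s := ProbabilityTheory.cdf_nonneg μ
  have h1 : ∀ s, F s ≤ 1 := ProbabilityTheory.cdf_le_one μ
  have hmn := hFm htp
  rcases (h0 t).eq_or_lt with ht0 | ht0
  · rw [← ht0]
    have := mul_nonneg ht.le (h0 p)
    linarith
  rcases (h1 p).eq_or_lt with hp1 | hp1
  · rw [hp1]
    have := mul_nonneg ht.le (sub_nonneg.2 (h1 t))
    linarith
  have ht1 : F t < 1 := hmn.trans_lt hp1
  obtain ⟨c, hc⟩ := h.exists_forall_sub_mul_le ht0 ht1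
  have hcp := hc p (ht0.trans_le hmn) hp1
  -- Prices at the lower end of the support sell with probability close to one.
  have hlow : -c ≤ (t - c) * (1 - F t) := by
    have hstep : ∀ ε, 0 < ε → ε < F t → -c * (1 - ε) ≤ (t - c) * (1 - F t) := by
      intro ε hε hεt
      obtain ⟨v, hv, hvε⟩ := intermediate_value_Icc ht.le h.continuous_cdf.continuousOn
        (show ε ∈ Set.Icc (F 0) (F t) from ⟨by rw [hF, h.cdf_zero]; exact hε.le, hεt.le⟩)
      have := hc v (by rw [hvε]; exact hε) (by rw [hvε]; linarith)
      rw [← hF] at hvε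
      rw [hvε] at this
      have := mul_nonneg hv.1 (show 0 ≤ 1 - ε by linarith)
      linarith
    have hlim : Filter.Tendsto (fun ε : ℝ => -c * (1 - ε)) (nhdsWithin 0 (Set.Ioi 0))
        (nhds (-c * (1 - 0))) :=
      ((continuous_const.mul (continuous_const.sub continuous_id)).tendsto 0).mono_left
        nhdsWithin_le_nhds
    have := le_of_tendsto hlim (by
      filter_upwards [Ioo_mem_nhdsGT ht0] with ε hε using hstep ε hε.1 hε.2)
    linarith
  have e1 := mul_le_mul_of_nonneg_right hcp (h0 t)
  have e2 := mul_le_mul_of_nonneg_right hlow (sub_nonneg.2 hmn)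
  nlinarith

lemma real_Ici_le_one (h : IsRegularDistribution μ) (t : ℝ) : μ.real (Set.Ici t) ≤ 1 := by
  have := h.1
  exact measureReal_le_one

/-- The revenues of a single bidder from posted prices are bounded. -/
lemma exists_mul_tail_le (h : IsRegularDistribution μ) :
    ∃ C, ∀ p, p * μ.real (Set.Ici p) ≤ C := by
  have hprob := h.1
  have hG := h.cdf_eq_one_sub
  obtain ⟨t, ht, hGt⟩ : ∃ t, 0 < t ∧ μ.real (Set.Ici t) < 1 := by
    have hlim := ProbabilityTheory.tendsto_cdf_atTop μ
    obtain ⟨t, ht, ht'⟩ := ((hlim.eventually (lt_mem_nhds (zero_lt_one))).and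
      (Filter.eventually_gt_atTop 0)).exists
    exact ⟨t, ht', by linarith [hG t]⟩
  refine ⟨t + t / (1 - μ.real (Set.Ici t)), fun p => ?_⟩
  have hpos : 0 < 1 - μ.real (Set.Ici t) := by linarith
  have hdiv : 0 ≤ t / (1 - μ.real (Set.Ici t)) := by positivity
  have hq0 : 0 ≤ μ.real (Set.Ici p) := measureReal_nonneg
  have hq1 := h.real_Ici_le_one p
  rcases le_total p t with hp | hp
  · nlinarith
  · have h1 := h.mul_tail_mul_le ht hp
    have h2 : p * μ.real (Set.Ici p) ≤ t / (1 - μ.real (Set.Ici t)) := by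
      rw [le_div_iff₀ hpos]
      refine h1.trans ?_
      have h3 : μ.real (Set.Ici t) * (1 - μ.real (Set.Ici p)) ≤ 1 :=
        mul_le_one₀ hGt.le (by linarith) (by linarith)
      nlinarith
    linarith

end IsRegularDistribution

/-- The largest revenue from a single bidder with value distribution `μ` at a posted price of at
least `τ`.  It is a supremum of reals, so its use requires a bound on the revenues. -/
noncomputable def postedPriceRevenue (μ : Measure ℝ) (τ : ℝ) : ℝ :=
  ⨆ p : Set.Ici τ, (p : ℝ) * μ.real (Set.Ici (p : ℝ))

namespace IsRegularDistribution

variable {μ : Measure ℝ}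

lemma le_postedPriceRevenue (h : IsRegularDistribution μ) {τ p : ℝ} (hp : τ ≤ p) :
    p * μ.real (Set.Ici p) ≤ postedPriceRevenue μ τ := by
  obtain ⟨C, hC⟩ := h.exists_mul_tail_le
  exact le_ciSup (f := fun p : Set.Ici τ => (p : ℝ) * μ.real (Set.Ici (p : ℝ)))
    ⟨C, by rintro _ ⟨p, rfl⟩; exact hC p⟩ ⟨p, hp⟩

lemma postedPriceRevenue_nonneg (h : IsRegularDistribution μ) {τ : ℝ} (hτ : 0 ≤ τ) :
    0 ≤ postedPriceRevenue μ τ :=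
  (mul_nonneg hτ measureReal_nonneg).trans (h.le_postedPriceRevenue le_rfl)

/-- Regularity bounds the tail at low prices from below by the revenue at high prices: with
`r` the revenue at prices of at least `τ`, the value exceeds `t ≤ τ` with probability at least
`r / (r + t)`. -/
lemma tail_bound (h : IsRegularDistribution μ) {t τ : ℝ} (ht : 0 < t) (htτ : t ≤ τ) :
    (1 - μ.real (Set.Ici t)) * (t + postedPriceRevenue μ τ) ≤ t := by
  have hG1 := h.real_Ici_le_one t
  rcases hG1.eq_or_lt with h1 | h1
  · rw [h1]; linarith
  have hpos : 0 < 1 - μ.real (Set.Ici t) := by linarith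
  have : postedPriceRevenue μ τ ≤ t * μ.real (Set.Ici t) / (1 - μ.real (Set.Ici t)) := by
    have : Nonempty (Set.Ici τ) := ⟨⟨τ, Set.mem_Ici.2 le_rfl⟩⟩
    refine ciSup_le fun p => ?_
    rw [le_div_iff₀ hpos]
    refine (h.mul_tail_mul_le ht (htτ.trans p.2)).trans ?_
    refine mul_le_of_le_one_right (mul_nonneg ht.le measureReal_nonneg) ?_
    linarith [measureReal_nonneg (μ := μ) (s := Set.Ici (p : ℝ))]
  rw [le_div_iff₀ hpos] at this
  linarith

lemma exists_postedPriceRevenue_pos (h : IsRegularDistribution μ) :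
    ∃ τ, 0 < τ ∧ 0 < postedPriceRevenue μ τ := by
  have hlim := (h.continuous_cdf.tendsto 0).mono_left
    (nhdsWithin_le_nhds (s := Set.Ioi (0 : ℝ)))
  rw [h.cdf_zero] at hlim
  obtain ⟨τ, h1, h2⟩ := ((hlim.eventually (gt_mem_nhds (zero_lt_one))).and
    self_mem_nhdsWithin).exists
  have h2 : 0 < τ := h2
  refine ⟨τ, h2, lt_of_lt_of_le ?_ (h.le_postedPriceRevenue le_rfl)⟩
  rw [h.cdf_eq_one_sub] at h1
  exact mul_pos h2 (by linarith)

end IsRegularDistribution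

/-! ### Revenue from a single bidder -/

/-- For a bounded allocation rule `X` that is monotone, the expectation of
`∫_τ^v (X v - X s) ds` is at most the best revenue `w` from a posted price.  Slicing `X` into its
superlevel sets `{X > u}` turns it into a mixture of posted prices, and for each of them the inner
integral is the length of `{s > τ : X s ≤ u}`, by which every value that wins exceeds `τ`. -/
lemma lintegral_lintegral_sub_le {ν : Measure ℝ} [IsProbabilityMeasure ν] {X : ℝ → ℝ}
    (hX : Monotone X) (hX0 : ∀ v, 0 ≤ X v) (hX1 : ∀ v, X v ≤ 1) {τ w : ℝ} (hτ : 0 ≤ τ)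
    (hw : ∀ p, τ ≤ p → p * ν.real (Set.Ici p) ≤ w) :
    ∫⁻ v, (∫⁻ s in Set.Ioo τ v, ENNReal.ofReal (X v - X s)) ∂ν ≤ ENNReal.ofReal w := by
  have hXm := hX.measurable
  -- the region under the integrand, as a set of triples `(v, s, u)`
  set R : Set (ℝ × ℝ × ℝ) := {q | τ < q.2.1 ∧ q.2.1 < q.1 ∧ X q.2.1 ≤ q.2.2 ∧ q.2.2 < X q.1} with hR
  have hRm : MeasurableSet R := by
    have e1 : Measurable fun q : ℝ × ℝ × ℝ => q.1 := by fun_prop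
    have e2 : Measurable fun q : ℝ × ℝ × ℝ => q.2.1 := by fun_prop
    have e3 : Measurable fun q : ℝ × ℝ × ℝ => q.2.2 := by fun_prop
    exact (measurableSet_lt measurable_const e2).inter ((measurableSet_lt e2 e1).inter
      ((measurableSet_le (hXm.comp e2) e3).inter (measurableSet_lt e3 (hXm.comp e1))))
  set ind : ℝ → ℝ → ℝ → ENNReal := fun v s u => R.indicator 1 (v, s, u) with hind
  have hindm : Measurable fun q : ℝ × ℝ × ℝ => ind q.1 q.2.1 q.2.2 :=
    (measurable_one.indicator hRm)
  have h1 : ∀ v, ∫⁻ s in Set.Ioo τ v, ENNReal.ofReal (X v - X s) = ∫⁻ s, ∫⁻ u, ind v s u := by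
    intro v
    rw [← lintegral_indicator measurableSet_Ioo]
    refine lintegral_congr fun s => ?_
    by_cases hs : s ∈ Set.Ioo τ v
    · rw [Set.indicator_of_mem hs, ← Real.volume_Ico, ← lintegral_indicator_one measurableSet_Ico]
      refine lintegral_congr fun u => ?_
      simp only [hind, Set.indicator, hR, Set.mem_ofPred_eq, Set.mem_Ico, hs.1, hs.2, true_and]
      rfl
    · rw [Set.indicator_of_notMem hs, eq_comm, lintegral_eq_zero_iff' (by fun_prop)]
      refine Filter.Eventually.of_forall fun u => ?_
      exact Set.indicator_of_notMem (fun h => hs ⟨h.1, h.2.1⟩) _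
  have h2 : ∀ u, ∫⁻ v, (∫⁻ s, ind v s u) ∂ν ≤
      Set.indicator (Set.Icc 0 1) (fun _ => ENNReal.ofReal w) u := by
    intro u
    have hmem : ∀ v s, ind v s u ≠ 0 → τ < s ∧ s < v ∧ X s ≤ u ∧ u < X v := fun v s h =>
      (Set.indicator_apply_ne_zero.1 h).1
    by_cases hv0 : ∃ v0, τ < v0 ∧ u < X v0 ∧ 0 ≤ u
    · obtain ⟨v0, hτv0, huv0, hu0⟩ := hv0
      rw [Set.indicator_of_mem (show u ∈ Set.Icc (0 : ℝ) 1 from ⟨hu0, huv0.le.trans (hX1 v0)⟩)]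
      set L : Set ℝ := {s | τ < s ∧ X s ≤ u} with hL
      have hLv : ∀ v, u < X v → L ⊆ Set.Ioo τ v := fun v hv s hs =>
        ⟨hs.1, by by_contra! h; exact absurd (hX h) (not_le.2 (hs.2.trans_lt hv))⟩
      have hLm : MeasurableSet L :=
        measurableSet_Ioi.inter (measurableSet_le hXm measurable_const)
      set ℓ := volume.real L with hℓ
      have hfin : volume L ≠ ⊤ := ne_top_of_le_ne_top (by simp) (measure_mono (hLv v0 huv0))
      have hℓ0 : 0 ≤ ℓ := measureReal_nonneg
      have hbound : ∀ v, ∫⁻ s, ind v s u ≤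
          (Set.Ici (τ + ℓ)).indicator (fun _ => ENNReal.ofReal ℓ) v := by
        intro v
        by_cases hv : τ < v ∧ u < X v
        · have hℓv : ℓ ≤ v - τ := by
            have := measureReal_mono (hLv v hv.2) (μ := volume) (by simp)
            rwa [Real.volume_real_Ioo_of_le hv.1.le] at this
          rw [Set.indicator_of_mem (show v ∈ Set.Ici (τ + ℓ) by
            rw [Set.mem_Ici]; linarith), hℓ, ofReal_measureReal hfin,
            ← lintegral_indicator_one hLm]
          refine lintegral_mono fun s => ?_
          by_cases h : ind v s u = 0
          · rw [h]; exact zero_le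
          · have h' := hmem v s h
            rw [Set.indicator_of_mem (show s ∈ L from ⟨h'.1, h'.2.2.1⟩)]
            exact Set.indicator_le_self _ _ _
        · refine le_of_eq_of_le ?_ zero_le
          rw [lintegral_eq_zero_iff' (by fun_prop)]
          refine Filter.Eventually.of_forall fun s => ?_
          by_contra h
          have h' := hmem v s h
          exact hv ⟨h'.1.trans h'.2.1, h'.2.2.2⟩
      refine (lintegral_mono hbound).trans ?_
      rw [lintegral_indicator_const measurableSet_Ici, ← ofReal_measureReal,
        ← ENNReal.ofReal_mul hℓ0]
      refine ENNReal.ofReal_le_ofReal (le_trans ?_ (hw (τ + ℓ) (by linarith)))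
      exact mul_le_mul_of_nonneg_right (by linarith) measureReal_nonneg
    · refine le_of_eq_of_le ?_ zero_le
      rw [lintegral_eq_zero_iff' (by fun_prop)]
      refine Filter.Eventually.of_forall fun v => ?_
      change ∫⁻ s, ind v s u = 0
      rw [lintegral_eq_zero_iff' (by fun_prop)]
      refine Filter.Eventually.of_forall fun s => ?_
      by_contra h
      have h' := hmem v s h
      exact hv0 ⟨v, h'.1.trans h'.2.1, h'.2.2.2, (hX0 s).trans h'.2.2.1⟩
  calc ∫⁻ v, (∫⁻ s in Set.Ioo τ v, ENNReal.ofReal (X v - X s)) ∂ν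
      = ∫⁻ v, (∫⁻ u, ∫⁻ s, ind v s u) ∂ν := by
        refine lintegral_congr fun v => ?_
        rw [h1 v]
        exact lintegral_lintegral_swap (by fun_prop)
    _ = ∫⁻ u, ∫⁻ v, (∫⁻ s, ind v s u) ∂ν := by
        refine lintegral_lintegral_swap ?_
        refine Measurable.aemeasurable ?_
        refine Measurable.lintegral_prod_right' (f := fun q : (ℝ × ℝ) × ℝ => ind q.1.1 q.2 q.1.2) ?_
        exact hindm.comp (by fun_prop : Measurable fun q : (ℝ × ℝ) × ℝ => (q.1.1, q.2, q.1.2))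
    _ ≤ ∫⁻ u, Set.indicator (Set.Icc 0 1) (fun _ => ENNReal.ofReal w) u := lintegral_mono h2
    _ = ENNReal.ofReal w := by
        rw [lintegral_indicator measurableSet_Icc]; simp

/-- In an incentive compatible and individually rational single-bidder mechanism `(X, P)` the
payment at `v` exceeds `τ X v` by at most `∫_τ^v (X v - X s) ds`. -/
lemma payment_sub_le {X P : ℝ → ℝ} (hX : Monotone X) (hX0 : ∀ v, 0 ≤ X v)
    (hIC : ∀ t b, 0 ≤ t → 0 ≤ b → X b * t - P b ≤ X t * t - P t)
    (hIR : ∀ t, 0 ≤ t → P t ≤ X t * t) {τ v : ℝ} (hτ : 0 ≤ τ) (hv : 0 ≤ v) :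
    ENNReal.ofReal (P v - τ * X v) ≤ ∫⁻ s in Set.Ioo τ v, ENNReal.ofReal (X v - X s) := by
  rcases le_total v τ with hvτ | hτv
  · rw [ENNReal.ofReal_of_nonpos]
    · exact zero_le
    · nlinarith [hIR v hv, hX0 v]
  have hint : ∀ a b, IntervalIntegrable X volume a b := fun a b => hX.intervalIntegrable
  -- the utility grows at least as fast as the integral of the allocation
  have henv : X τ * τ - P τ - ∫ s in τ..τ, X s ≤ X v * v - P v - ∫ s in τ..v, X s := by
    refine le_of_forall_sub_le_mul_sub (D := fun v => X v * v - P v - ∫ s in τ..v, X s) (m := X)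
      hτv fun a b hτa hab hbv => ?_
    have h1 := hIC b a (by linarith) (by linarith)
    have h2 : ∫ s in τ..b, X s = (∫ s in τ..a, X s) + ∫ s in a..b, X s :=
      (intervalIntegral.integral_add_adjacent_intervals (hint _ _) (hint _ _)).symm
    have h3 : ∫ s in a..b, X s ≤ ∫ _ in a..b, X b :=
      intervalIntegral.integral_mono_on hab (hint _ _) (by simp) fun s hs => hX hs.2
    rw [intervalIntegral.integral_const, smul_eq_mul] at h3
    rw [h2]
    linarith
  rw [intervalIntegral.integral_same] at henv
  have h4 := hIR τ hτ
  have h5 : ∫ s in Set.Ioo τ v, (X v - X s) = X v * (v - τ) - ∫ s in τ..v, X s := by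
    rw [← integral_Ioc_eq_integral_Ioo, ← intervalIntegral.integral_of_le hτv,
      intervalIntegral.integral_sub (by simp) (hint _ _), intervalIntegral.integral_const,
      smul_eq_mul, mul_comm]
  rw [← ofReal_integral_eq_lintegral_ofReal]
  · refine ENNReal.ofReal_le_ofReal ?_
    rw [h5]
    linarith
  · have := ((hint τ v).1.mono_set Set.Ioo_subset_Ioc_self)
    exact (integrable_const _).sub this
  · filter_upwards [self_mem_ae_restrict measurableSet_Ioo] with s hs
    exact sub_nonneg.2 (hX hs.2.le)

/-- The revenue from a single bidder is at most `τ` times the probability of sale plus the largest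
revenue from a posted price of at least `τ`. -/
lemma integral_payment_le {ν : Measure ℝ} [IsProbabilityMeasure ν] (hν : ν (Set.Iio 0) = 0)
    {X P : ℝ → ℝ} (hX0 : ∀ v, 0 ≤ v → 0 ≤ X v) (hX1 : ∀ v, 0 ≤ v → X v ≤ 1)
    (hIC : ∀ t b, 0 ≤ t → 0 ≤ b → X b * t - P b ≤ X t * t - P t)
    (hIR : ∀ t, 0 ≤ t → P t ≤ X t * t) (hP : Integrable P ν) {τ w : ℝ} (hτ : 0 ≤ τ)
    (hw : ∀ p, τ ≤ p → p * ν.real (Set.Ici p) ≤ w) :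
    ∫ v, P v ∂ν ≤ τ * ∫ v, X v ∂ν + w := by
  have hae : ∀ᵐ v ∂ν, 0 ≤ v := by
    filter_upwards [measure_eq_zero_iff_ae_notMem.1 hν] with v hv using not_lt.1 hv
  -- extend `X` to a monotone function on the whole line
  set Y : ℝ → ℝ := fun v => X (max v 0) with hY
  have hYX : ∀ v, 0 ≤ v → Y v = X v := fun v hv => by rw [hY]; simp only [max_eq_left hv]
  have hXmono : ∀ s t, 0 ≤ s → s ≤ t → X s ≤ X t := by
    intro s t hs hst
    rcases hst.eq_or_lt with rfl | hlt
    · exact le_rfl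
    have h1 := hIC t s (by linarith) hs
    have h2 := hIC s t hs (by linarith)
    by_contra! h3
    nlinarith
  have hYm : Monotone Y := fun s t hst =>
    hXmono _ _ (le_max_right _ _) (max_le_max_right 0 hst)
  have hY0 : ∀ v, 0 ≤ Y v := fun v => hX0 _ (le_max_right _ _)
  have hY1 : ∀ v, Y v ≤ 1 := fun v => hX1 _ (le_max_right _ _)
  have hYi : Integrable Y ν :=
    Integrable.of_bound hYm.measurable.aestronglyMeasurable 1
      (ae_of_all _ fun v => by rw [Real.norm_of_nonneg (hY0 v)]; exact hY1 v)
  have hw0 : 0 ≤ w := (mul_nonneg hτ measureReal_nonneg).trans (hw τ le_rfl)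
  have h1 : ∫⁻ v, ENNReal.ofReal (P v - τ * Y v) ∂ν ≤ ENNReal.ofReal w := by
    refine le_trans (lintegral_mono_ae ?_) (lintegral_lintegral_sub_le hYm hY0 hY1 hτ hw)
    filter_upwards [hae] with v hv
    refine payment_sub_le hYm hY0 (fun t b ht hb => ?_) (fun t ht => ?_) hτ hv
    · rw [hYX t ht, hYX b hb]; exact hIC t b ht hb
    · rw [hYX t ht]; exact hIR t ht
  have h2 : ∫ v, (P v - τ * Y v) ∂ν ≤ w := by
    have := integral_eq_lintegral_pos_part_sub_lintegral_neg_part (hP.sub (hYi.const_mul τ))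
    have h3 := ENNReal.toReal_mono ENNReal.ofReal_ne_top h1
    rw [ENNReal.toReal_ofReal hw0] at h3
    simp only [Pi.sub_apply] at this
    rw [this]
    have : 0 ≤ (∫⁻ a, ENNReal.ofReal (-(P a - τ * Y a)) ∂ν).toReal := ENNReal.toReal_nonneg
    linarith
  have h3 : ∫ v, X v ∂ν = ∫ v, Y v ∂ν :=
    integral_congr_ae (by filter_upwards [hae] with v hv using (hYX v hv).symm)
  rw [integral_sub hP (hYi.const_mul τ), integral_const_mul] at h2
  rw [h3]
  linarith

/-! ### The upper bound on the optimal revenue -/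

/-- Redrawing one coordinate independently leaves the product distribution unchanged. -/
lemma measurePreserving_update {n : ℕ} (μ : Fin n → Measure ℝ) [∀ i, IsProbabilityMeasure (μ i)]
    (i : Fin n) :
    MeasurePreserving (fun p : ℝ × (Fin n → ℝ) => Function.update p.2 i p.1)
      ((μ i).prod (Measure.pi μ)) (Measure.pi μ) := by
  have hm : Measurable fun p : ℝ × (Fin n → ℝ) => Function.update p.2 i p.1 :=
    measurable_update'.comp measurable_swap
  refine ⟨hm, (Measure.pi_eq fun s hs => ?_).symm⟩
  rw [Measure.map_apply hm (MeasurableSet.univ_pi hs)]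
  have : (fun p : ℝ × (Fin n → ℝ) => Function.update p.2 i p.1) ⁻¹' Set.univ.pi s =
      s i ×ˢ Set.univ.pi (Function.update s i Set.univ) := by
    ext p
    simp only [Set.mem_preimage, Set.mem_univ_pi, Set.mem_prod]
    constructor
    · intro h
      refine ⟨by simpa using h i, fun j => ?_⟩
      by_cases hj : j = i
      · subst hj; simp
      · simpa [hj] using h j
    · rintro ⟨h1, h2⟩ j
      by_cases hj : j = i
      · subst hj; simpa using h1
      · simpa [hj] using h2 j
  rw [this, Measure.prod_prod, Measure.pi_pi, ← Finset.mul_prod_erase _ _ (Finset.mem_univ i),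
    ← Finset.mul_prod_erase Finset.univ (fun j => μ j (s j)) (Finset.mem_univ i)]
  simp only [Function.update_self, measure_univ, one_mul]
  congr 1
  refine Finset.prod_congr rfl fun j hj => ?_
  rw [Function.update_of_ne (Finset.ne_of_mem_erase hj)]

lemma ae_pi_nonneg {n : ℕ} {μ : Fin n → Measure ℝ} [∀ i, IsProbabilityMeasure (μ i)]
    (h0 : ∀ i, μ i (Set.Iio 0) = 0) : ∀ᵐ v ∂Measure.pi μ, ∀ j, 0 ≤ v j := by
  rw [ae_all_iff]
  intro j
  have h := (measurePreserving_eval μ j).quasiMeasurePreserving.ae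
    (p := fun x : ℝ => 0 ≤ x) (by
      filter_upwards [measure_eq_zero_iff_ae_notMem.1 (h0 j)] with v hv using not_lt.1 hv)
  exact h

namespace Auction

variable {n : ℕ}

lemma alloc_le_one (A : Auction n) {v : Fin n → ℝ} (hv : ∀ j, 0 ≤ v j) (i : Fin n) :
    A.alloc v i ≤ 1 :=
  (Finset.single_le_sum (fun j _ => A.alloc_nonneg v hv j) (Finset.mem_univ i)).trans
    (A.alloc_sum_le_one v hv)

lemma update_nonneg {v : Fin n → ℝ} (hv : ∀ j, 0 ≤ v j) (i : Fin n) {b : ℝ} (hb : 0 ≤ b) (j : Fin n) :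
    0 ≤ Function.update v i b j := by
  by_cases hj : j = i
  · subst hj; simpa using hb
  · simpa [hj] using hv j

lemma integrable_alloc (A : Auction n) {μ : Fin n → Measure ℝ} [∀ i, IsProbabilityMeasure (μ i)]
    (h0 : ∀ i, μ i (Set.Iio 0) = 0) (i : Fin n) :
    Integrable (fun v => A.alloc v i) (Measure.pi μ) := by
  refine Integrable.of_bound (A.measurable_alloc i).aestronglyMeasurable 1 ?_
  filter_upwards [ae_pi_nonneg h0] with v hv
  rw [Real.norm_of_nonneg (A.alloc_nonneg v hv i)]
  exact A.alloc_le_one hv i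

lemma integrable_alloc_update (A : Auction n) {μ : Fin n → Measure ℝ}
    [∀ i, IsProbabilityMeasure (μ i)] (h0 : ∀ i, μ i (Set.Iio 0) = 0) (i : Fin n) {b : ℝ}
    (hb : 0 ≤ b) :
    Integrable (fun w => A.alloc (Function.update w i b) i) (Measure.pi μ) := by
  refine Integrable.of_bound
    ((A.measurable_alloc i).comp measurable_update_left).aestronglyMeasurable 1 ?_
  filter_upwards [ae_pi_nonneg h0] with v hv
  rw [Real.norm_of_nonneg (A.alloc_nonneg _ (update_nonneg hv i hb) i)]
  exact A.alloc_le_one (update_nonneg hv i hb) i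

lemma interimAlloc_nonneg (A : Auction n) {μ : Fin n → Measure ℝ}
    [∀ i, IsProbabilityMeasure (μ i)] (h0 : ∀ i, μ i (Set.Iio 0) = 0) (i : Fin n) {b : ℝ}
    (hb : 0 ≤ b) : 0 ≤ A.interimAlloc μ i b := by
  refine integral_nonneg_of_ae ?_
  filter_upwards [ae_pi_nonneg h0] with v hv using A.alloc_nonneg _ (update_nonneg hv i hb) i

lemma interimAlloc_le_one (A : Auction n) {μ : Fin n → Measure ℝ}
    [∀ i, IsProbabilityMeasure (μ i)] (h0 : ∀ i, μ i (Set.Iio 0) = 0) (i : Fin n) {b : ℝ}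
    (hb : 0 ≤ b) : A.interimAlloc μ i b ≤ 1 := by
  have h : A.interimAlloc μ i b ≤ ∫ _, (1 : ℝ) ∂Measure.pi μ := by
    refine integral_mono_ae (A.integrable_alloc_update h0 i hb) (integrable_const _) ?_
    filter_upwards [ae_pi_nonneg h0] with v hv using A.alloc_le_one (update_nonneg hv i hb) i
  simpa using h

lemma interimPay_le (A : Auction n) {μ : Fin n → Measure ℝ} [∀ i, IsProbabilityMeasure (μ i)]
    (h0 : ∀ i, μ i (Set.Iio 0) = 0) (hIR : A.IsIndividuallyRational) (hIC : A.IsBayesianIC μ)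
    (i : Fin n) {b : ℝ} (hb : 0 ≤ b) : A.interimPay μ i b ≤ A.interimAlloc μ i b * b := by
  rw [interimAlloc, interimPay, ← integral_mul_const]
  refine integral_mono_ae (hIC.1 i b hb) ((A.integrable_alloc_update h0 i hb).mul_const b) ?_
  filter_upwards [ae_pi_nonneg h0] with v hv
  have := hIR _ (update_nonneg hv i hb) i
  rw [Function.update_self] at this
  linarith

/-- Taking the expectation of a rule over all bids is the same as taking that of its interim
version. -/
lemma integrable_and_integral_interim {μ : Fin n → Measure ℝ} [∀ i, IsProbabilityMeasure (μ i)]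
    (i : Fin n) {g : (Fin n → ℝ) → ℝ} (hg : Integrable g (Measure.pi μ)) :
    Integrable (fun b => ∫ w, g (Function.update w i b) ∂Measure.pi μ) (μ i) ∧
    ∫ b, ∫ w, g (Function.update w i b) ∂Measure.pi μ ∂μ i = ∫ v, g v ∂Measure.pi μ := by
  have hmp := measurePreserving_update μ i
  have hint : Integrable (fun p : ℝ × (Fin n → ℝ) => g (Function.update p.2 i p.1))
      ((μ i).prod (Measure.pi μ)) := hmp.integrable_comp_of_integrable hg
  refine ⟨hint.integral_prod_left, ?_⟩
  rw [← integral_prod (fun p : ℝ × (Fin n → ℝ) => g (Function.update p.2 i p.1)) hint]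
  conv_rhs => rw [← hmp.map_eq]
  rw [integral_map hmp.measurable.aemeasurable]
  rw [hmp.map_eq]
  exact hg.aestronglyMeasurable

/-- No incentive compatible auction earns more than `τ` plus the sum over the bidders of the best
revenues from posted prices of at least `τ`: sales at prices below `τ` bring at most `τ` each, and
there is only one item. -/
lemma revenue_le (B : Auction n) {μ : Fin n → Measure ℝ} (hμ : ∀ i, IsRegularDistribution (μ i))
    (hIR : B.IsIndividuallyRational) (hIC : B.IsBayesianIC μ) (hP : B.HasExpectedPayments μ)
    {τ : ℝ} (hτ : 0 ≤ τ) : B.revenue μ ≤ τ + ∑ i, postedPriceRevenue (μ i) τ := by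
  have hprob : ∀ i, IsProbabilityMeasure (μ i) := fun i => (hμ i).1
  have h0 : ∀ i, μ i (Set.Iio 0) = 0 := fun i => (hμ i).2.1
  have hi : ∀ i, ∫ v, B.pay v i ∂Measure.pi μ ≤
      τ * (∫ v, B.alloc v i ∂Measure.pi μ) + postedPriceRevenue (μ i) τ := by
    intro i
    obtain ⟨h1, h2⟩ := integrable_and_integral_interim i (hP i)
    obtain ⟨-, h4⟩ := integrable_and_integral_interim i (B.integrable_alloc h0 i)
    rw [← h2, ← h4]
    exact integral_payment_le (h0 i) (fun v hv => B.interimAlloc_nonneg h0 i hv)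
      (fun v hv => B.interimAlloc_le_one h0 i hv) (hIC.2 i)
      (fun t ht => B.interimPay_le h0 hIR hIC i ht) h1 hτ
      fun p hp => (hμ i).le_postedPriceRevenue hp
  have hsum : ∑ i, ∫ v, B.alloc v i ∂Measure.pi μ ≤ 1 := by
    rw [← integral_finsetSum _ fun i _ => B.integrable_alloc h0 i]
    have : ∫ v, ∑ i, B.alloc v i ∂Measure.pi μ ≤ ∫ _, (1 : ℝ) ∂Measure.pi μ := by
      refine integral_mono_ae (integrable_finsetSum _ fun i _ => B.integrable_alloc h0 i)
        (integrable_const _) ?_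
      filter_upwards [ae_pi_nonneg h0] with v hv using B.alloc_sum_le_one v hv
    simpa using this
  rw [revenue, integral_finsetSum _ fun i _ => hP i]
  refine (Finset.sum_le_sum fun i _ => hi i).trans ?_
  rw [Finset.sum_add_distrib, ← Finset.mul_sum]
  have := mul_le_mul_of_nonneg_left hsum hτ
  linarith

end Auction

/-! ### Division of the bidders and pooling of their tails -/

/-- Nonnegative weights, none of which exceeds all the others together because each of them occurs
twice, can be divided into two parts that both have at least a third of the total. -/
lemma exists_third_le_sum {ι : Type*} [Fintype ι] [DecidableEq ι] {w : ι → ℝ} (hw : ∀ i, 0 ≤ w i)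
    (htwin : ∀ i, ∃ j, j ≠ i ∧ w j = w i) :
    ∃ A : Finset ι, (∑ i, w i) / 3 ≤ ∑ i ∈ A, w i ∧ (∑ i, w i) / 3 ≤ ∑ i ∈ Aᶜ, w i := by
  by_cases hbig : ∃ i, (∑ i, w i) / 3 ≤ w i
  · obtain ⟨i, hi⟩ := hbig
    obtain ⟨j, hj, hji⟩ := htwin i
    refine ⟨{i}, by simpa using hi, ?_⟩
    rw [← hji] at hi
    exact hi.trans (Finset.single_le_sum (fun k _ => hw k) (by simpa using hj))
  push Not at hbig
  have hW : 0 ≤ ∑ i, w i := Finset.sum_nonneg fun i _ => hw i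
  obtain ⟨A, hA⟩ := Set.Finite.exists_minimal
    (s := {A : Finset ι | (∑ i, w i) / 3 ≤ ∑ i ∈ A, w i}) (Set.toFinite _)
    ⟨Finset.univ, show (∑ i, w i) / 3 ≤ ∑ i, w i by linarith⟩
  have hA1 : (∑ i, w i) / 3 ≤ ∑ i ∈ A, w i := hA.1
  refine ⟨A, hA1, ?_⟩
  have hsplit := Finset.sum_add_sum_compl A w
  rcases A.eq_empty_or_nonempty with rfl | ⟨a, ha⟩
  · simp only [Finset.sum_empty] at hsplit; linarith
  · have h1 : ∑ i ∈ A.erase a, w i < (∑ i, w i) / 3 := by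
      by_contra! h
      exact Finset.notMem_erase a A (hA.2 (show A.erase a ∈ {A : Finset ι | _} from h)
        (Finset.erase_subset a A) ha)
    have h2 := Finset.add_sum_erase A w ha
    have h3 := hbig a
    linarith

/-- The pooling inequality `∏ t / (t + wᵢ) ≤ t / (t + ∑ wᵢ)`, for factors that are at most
`t / (t + wᵢ)`. -/
lemma prod_mul_add_sum_le {ι : Type*} {w F : ι → ℝ} {t : ℝ} (ht : 0 < t) (s : Finset ι)
    (hw : ∀ i ∈ s, 0 ≤ w i) (hF : ∀ i ∈ s, 0 ≤ F i) (h : ∀ i ∈ s, F i * (t + w i) ≤ t) :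
    (∏ i ∈ s, F i) * (t + ∑ i ∈ s, w i) ≤ t := by
  classical
  induction s using Finset.induction_on with
  | empty => simp
  | insert a s ha ih =>
    have ih := ih (fun i hi => hw i (Finset.mem_insert_of_mem hi))
      (fun i hi => hF i (Finset.mem_insert_of_mem hi))
      (fun i hi => h i (Finset.mem_insert_of_mem hi))
    have ha1 := h a (Finset.mem_insert_self a s)
    have ha2 := hw a (Finset.mem_insert_self a s)
    have ha3 := hF a (Finset.mem_insert_self a s)
    have hs : 0 ≤ ∑ i ∈ s, w i :=
      Finset.sum_nonneg fun i hi => hw i (Finset.mem_insert_of_mem hi)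
    have hp : 0 ≤ ∏ i ∈ s, F i :=
      Finset.prod_nonneg fun i hi => hF i (Finset.mem_insert_of_mem hi)
    rw [Finset.prod_insert ha, Finset.sum_insert ha]
    have h1 := mul_le_mul ha1 ih (by positivity) ht.le
    have h2 : 0 ≤ F a * (∏ i ∈ s, F i) * (w a * ∑ i ∈ s, w i) := by positivity
    have h3 : t * (F a * (∏ i ∈ s, F i) * (t + (w a + ∑ i ∈ s, w i))) ≤ t * t := by linarith
    exact le_of_mul_le_mul_left h3 ht

/-- If all of several events fail with probability `q ≤ t / (t + T)`, then one of them occurs with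
probability at least `S / (S + t)`, for every `S ≤ T`. -/
lemma div_add_le_one_sub {q S T t : ℝ} (ht : 0 < t) (hS : 0 ≤ S) (hST : S ≤ T)
    (h : q * (t + T) ≤ t) : S / (S + t) ≤ 1 - q := by
  have hT : 0 < t + T := by linarith
  have h1 : q ≤ t / (t + T) := by rwa [le_div_iff₀ hT]
  have h2 : t / (t + T) ≤ t / (S + t) :=
    div_le_div_of_nonneg_left ht.le (by linarith) (by linarith)
  have h3 : S / (S + t) = 1 - t / (S + t) := by field_simp; ring
  linarith

/-- With independent bids, and the bidders divided into `A` and its complement, the probability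
that the second highest bid is at least `t` is at least that of a bid of `t` or more on either
side. -/
lemma measureReal_two_le {n : ℕ} {μ : Fin n → Measure ℝ} [∀ i, IsProbabilityMeasure (μ i)] {t : ℝ}
    (A : Finset (Fin n)) :
    (1 - ∏ i ∈ A, (μ i).real (Set.Iio t)) * (1 - ∏ i ∈ Aᶜ, (μ i).real (Set.Iio t)) ≤
      (Measure.pi μ).real {v | ∃ i j, i ≠ j ∧ t ≤ v i ∧ t ≤ v j} := by
  classical
  set N : Finset (Fin n) → Set (Fin n → ℝ) := fun s =>
    Set.univ.pi fun i => if i ∈ s then Set.Iio t else Set.univ with hN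
  have hNmem : ∀ s v, v ∈ N s ↔ ∀ i ∈ s, v i < t := by
    intro s v
    simp only [hN, Set.mem_univ_pi]
    refine forall_congr' fun i => ?_
    by_cases hi : i ∈ s <;> simp [hi]
  have hNm : ∀ s, MeasurableSet (N s) := fun s => MeasurableSet.univ_pi fun i => by
    by_cases hi : i ∈ s <;> simp [hi]
  have hNp : ∀ s, (Measure.pi μ).real (N s) = ∏ i ∈ s, (μ i).real (Set.Iio t) := by
    intro s
    rw [Measure.real, Measure.pi_pi, ENNReal.toReal_prod, ← Finset.prod_subset (Finset.subset_univ s)]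
    · exact Finset.prod_congr rfl fun i hi => by simp [hi, Measure.real]
    · intro i _ hi; simp [hi]
  have hsub : (N A ∪ N Aᶜ)ᶜ ⊆ {v | ∃ i j, i ≠ j ∧ t ≤ v i ∧ t ≤ v j} := by
    intro v hv
    simp only [Set.mem_compl_iff, Set.mem_union, hNmem, not_or, not_forall, not_lt] at hv
    obtain ⟨⟨i, hi, hti⟩, ⟨j, hj, htj⟩⟩ := hv
    exact ⟨i, j, fun h => (Finset.mem_compl.1 hj) (h ▸ hi), hti, htj⟩
  refine le_trans (le_of_eq ?_) (measureReal_mono hsub)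
  rw [probReal_compl_eq_one_sub ((hNm _).union (hNm _))]
  have h1 := measureReal_union_add_inter (μ := Measure.pi μ) (s := N A) (hNm Aᶜ)
  have h2 : N A ∩ N Aᶜ = N Finset.univ := by
    ext v
    simp only [Set.mem_inter_iff, hNmem, Finset.mem_compl, Finset.mem_univ, true_imp_iff]
    exact ⟨fun h i => by by_cases hi : i ∈ A; exacts [h.1 i hi, h.2 i hi],
      fun h => ⟨fun i _ => h i, fun i _ => h i⟩⟩
  rw [h2, hNp, hNp, hNp] at h1
  have h3 := Finset.prod_mul_prod_compl A fun i => (μ i).real (Set.Iio t)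
  rw [← h3] at h1
  linarith

lemma integral_sq_div_add {S τ : ℝ} (hS : 0 < S) (hτ : 0 ≤ τ) :
    ∫ t in (0 : ℝ)..τ, (S / (S + t)) ^ 2 = S * τ / (S + τ) := by
  have hne : ∀ t ∈ Set.uIcc 0 τ, S + t ≠ 0 := fun t ht => by
    rw [Set.uIcc_of_le hτ] at ht; linarith [ht.1]
  rw [intervalIntegral.integral_eq_sub_of_hasDerivAt (f := fun t => S * t / (S + t))]
  · simp
  · intro t ht
    have h1 := ((hasDerivAt_id t).const_mul S).div ((hasDerivAt_id t).const_add S) (hne t ht)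
    refine h1.congr_deriv ?_
    simp only [id_eq]
    rw [div_pow]
    ring
  · refine ContinuousOn.intervalIntegrable ?_
    exact (continuousOn_const.div (by fun_prop) hne).pow 2

/-! ### The second price auction -/

namespace SecondPrice

variable {n : ℕ}

/-- The highest of the other bids, and `0` if there is no other bidder. -/
noncomputable def threshold (v : Fin n → ℝ) (i : Fin n) : ℝ :=
  ((Finset.univ.erase i).sup fun j => (v j).toNNReal : NNReal)

/-- Bidder `i` has the highest bid; ties go to the bidder with the lowest index. -/
def Wins (v : Fin n → ℝ) (i : Fin n) : Prop :=
  (∀ j, j < i → v j < v i) ∧ ∀ j, i < j → v j ≤ v i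

lemma threshold_nonneg (v : Fin n → ℝ) (i : Fin n) : 0 ≤ threshold v i := NNReal.coe_nonneg _

lemma le_threshold (v : Fin n → ℝ) {i j : Fin n} (h : j ≠ i) : v j ≤ threshold v i := by
  refine (Real.le_coe_toNNReal (v j)).trans (NNReal.coe_le_coe.2 ?_)
  exact Finset.le_sup (f := fun j => (v j).toNNReal) (Finset.mem_erase.2 ⟨h, Finset.mem_univ j⟩)

lemma threshold_le {v : Fin n → ℝ} {i : Fin n} {x : ℝ} (hx : 0 ≤ x) (h : ∀ j, j ≠ i → v j ≤ x) :
    threshold v i ≤ x := by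
  lift x to NNReal using hx
  refine NNReal.coe_le_coe.2 (Finset.sup_le fun j hj => ?_)
  exact Real.toNNReal_le_iff_le_coe.2 (h j (Finset.ne_of_mem_erase hj))

lemma threshold_update (v : Fin n → ℝ) (i : Fin n) (b : ℝ) :
    threshold (Function.update v i b) i = threshold v i := by
  unfold threshold
  congr 1
  refine Finset.sup_congr rfl fun j hj => ?_
  rw [Function.update_of_ne (Finset.ne_of_mem_erase hj)]

lemma Wins.threshold_le {v : Fin n → ℝ} {i : Fin n} (hv : 0 ≤ v i) (h : Wins v i) :
    threshold v i ≤ v i :=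
  SecondPrice.threshold_le hv fun j hj => by
    rcases lt_or_gt_of_ne hj with hj | hj
    exacts [(h.1 j hj).le, h.2 j hj]

lemma le_threshold_of_not_wins {v : Fin n → ℝ} {i : Fin n} (h : ¬ Wins v i) :
    v i ≤ threshold v i := by
  rw [Wins, not_and_or] at h
  push Not at h
  rcases h with ⟨j, hj, hij⟩ | ⟨j, hj, hij⟩
  exacts [hij.trans (le_threshold v hj.ne), hij.le.trans (le_threshold v hj.ne')]

lemma Wins.unique {v : Fin n → ℝ} {i j : Fin n} (hi : Wins v i) (hj : Wins v j) : i = j := by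
  rcases lt_trichotomy i j with h | h | h
  · exact absurd (hj.1 i h) (not_lt.2 (hi.2 j h))
  · exact h
  · exact absurd (hi.1 j h) (not_lt.2 (hj.2 i h))

lemma exists_wins (hn : 0 < n) (v : Fin n → ℝ) : ∃ i, Wins v i := by
  have : Nonempty (Fin n) := ⟨⟨0, hn⟩⟩
  obtain ⟨i, hi⟩ := Finite.exists_max fun i => toLex (v i, OrderDual.toDual i)
  refine ⟨i, fun j hj => ?_, fun j hj => ?_⟩
  · rcases Prod.Lex.toLex_le_toLex.1 (hi j) with h | h
    · exact h
    · exact absurd (OrderDual.toDual_le_toDual.1 h.2) (not_le.2 hj)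
  · rcases Prod.Lex.toLex_le_toLex.1 (hi j) with h | h
    exacts [h.le, h.1.le]

lemma measurableSet_wins (i : Fin n) : MeasurableSet {v : Fin n → ℝ | Wins v i} := by
  have : {v : Fin n → ℝ | Wins v i} =
      (⋂ j, ⋂ (_ : j < i), {v | v j < v i}) ∩ ⋂ j, ⋂ (_ : i < j), {v | v j ≤ v i} := by
    ext v
    simp [Wins]
  rw [this]
  exact (MeasurableSet.iInter fun j => MeasurableSet.iInter fun _ =>
      measurableSet_lt (measurable_pi_apply j) (measurable_pi_apply i)).inter
    (MeasurableSet.iInter fun j => MeasurableSet.iInter fun _ =>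
      measurableSet_le (measurable_pi_apply j) (measurable_pi_apply i))

lemma measurable_threshold (i : Fin n) : Measurable fun v : Fin n → ℝ => threshold v i := by
  refine measurable_coe_nnreal_real.comp ?_
  have : (fun v : Fin n → ℝ => (Finset.univ.erase i).sup fun j => (v j).toNNReal) =
      (Finset.univ.erase i).sup fun j v => (v j).toNNReal := by
    ext v
    simp [Finset.sup_apply]
  rw [this]
  exact Finset.sup_induction measurable_const (fun _ hf _ hg => hf.sup hg)
    fun j _ => (measurable_pi_apply j).real_toNNReal

open Classical in
/-- The second price auction: the highest bidder wins and pays the highest other bid. -/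
noncomputable def auction (n : ℕ) : Auction n where
  alloc v i := if Wins v i then 1 else 0
  pay v i := if Wins v i then threshold v i else 0
  measurable_alloc i := Measurable.ite (measurableSet_wins i) measurable_const measurable_const
  measurable_pay i := Measurable.ite (measurableSet_wins i) (measurable_threshold i) measurable_const
  alloc_nonneg v _ i := by split_ifs <;> simp
  alloc_sum_le_one v _ := by
    rw [Finset.sum_boole]
    have : (Finset.univ.filter fun i => Wins v i).card ≤ 1 :=
      Finset.card_le_one.2 fun i hi j hj =>
        (Finset.mem_filter.1 hi).2.unique (Finset.mem_filter.1 hj).2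
    exact_mod_cast this

lemma isIndividuallyRational : (auction n).IsIndividuallyRational := by
  classical
  intro v hv i
  by_cases h : Wins v i
  · simpa [auction, h] using h.threshold_le (hv i)
  · simp [auction, h]

lemma isDominantStrategyIC : (auction n).IsDominantStrategyIC := by
  classical
  intro v hv i b hb
  have h1 := isIndividuallyRational v hv i
  by_cases hb' : Wins (Function.update v i b) i
  · by_cases h : Wins v i
    · simp [auction, h, hb', threshold_update]
    · simpa [auction, h, hb', threshold_update] using le_threshold_of_not_wins h
  · simpa [auction, hb'] using h1

lemma pay_nonneg (v : Fin n → ℝ) (i : Fin n) : 0 ≤ (auction n).pay v i := by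
  simp only [auction]
  split_ifs
  exacts [threshold_nonneg v i, le_rfl]

/-- The payments add up to at least `t` if two bids are at least `t`. -/
lemma le_sum_pay {v : Fin n → ℝ} {t : ℝ} (h : ∃ i j, i ≠ j ∧ t ≤ v i ∧ t ≤ v j) :
    t ≤ ∑ i, (auction n).pay v i := by
  obtain ⟨i, j, hij, hi, hj⟩ := h
  obtain ⟨k, hk⟩ := exists_wins i.pos v
  have h1 : t ≤ (auction n).pay v k := by
    simp only [auction, hk, if_true]
    by_cases h : i = k
    · subst h; exact hj.trans (le_threshold v hij.symm)
    · exact hi.trans (le_threshold v h)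
  exact h1.trans (Finset.single_le_sum (fun i _ => pay_nonneg v i) (Finset.mem_univ k))

lemma pay_le {v : Fin n → ℝ} (hv : ∀ j, 0 ≤ v j) (i : Fin n) :
    (auction n).pay v i ≤ ∑ j ∈ Finset.univ.erase i, min (v i) (v j) := by
  have hsum0 : 0 ≤ ∑ j ∈ Finset.univ.erase i, min (v i) (v j) :=
    Finset.sum_nonneg fun j _ => le_min (hv i) (hv j)
  by_cases h : Wins v i
  · simp only [auction, h, if_true]
    refine threshold_le hsum0 fun j hj => ?_
    have h1 : v j ≤ v i := (le_threshold v hj).trans (h.threshold_le (hv i))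
    have h2 := Finset.single_le_sum (f := fun j => min (v i) (v j))
      (fun j _ => le_min (hv i) (hv j)) (Finset.mem_erase.2 ⟨hj, Finset.mem_univ j⟩)
    simpa [min_eq_right h1] using h2
  · simpa [auction, h] using hsum0

/-! ### Revenue of the second price auction -/

/-- The smaller of two independent regular values has an expectation, although the values
themselves need not: their tails are `O(1/t)`, so that of the minimum is `O(1/t²)`. -/
lemma integrable_min {μ : Fin n → Measure ℝ} (hμ : ∀ i, IsRegularDistribution (μ i))
    {i j : Fin n} (hij : i ≠ j) : Integrable (fun v => min (v i) (v j)) (Measure.pi μ) := by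
  have hprob : ∀ i, IsProbabilityMeasure (μ i) := fun i => (hμ i).1
  have h0 : ∀ᵐ v ∂Measure.pi μ, 0 ≤ min (v i) (v j) := by
    filter_upwards [ae_pi_nonneg fun i => (hμ i).2.1] with v hv using le_min (hv i) (hv j)
  have hm : Measurable fun v : Fin n → ℝ => min (v i) (v j) :=
    (measurable_pi_apply i).min (measurable_pi_apply j)
  refine ⟨hm.aestronglyMeasurable, ?_⟩
  rw [hasFiniteIntegral_iff_ofReal h0, lintegral_eq_lintegral_meas_le _ h0 hm.aemeasurable]
  have htail : ∀ t, (Measure.pi μ) {v | t ≤ min (v i) (v j)} =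
      μ i (Set.Ici t) * μ j (Set.Ici t) := by
    intro t
    have : {v : Fin n → ℝ | t ≤ min (v i) (v j)} =
        Set.univ.pi fun k => if k = i ∨ k = j then Set.Ici t else Set.univ := by
      ext v
      simp only [Set.mem_ofPred_eq, le_min_iff, Set.mem_univ_pi]
      constructor
      · rintro ⟨h1, h2⟩ k
        by_cases hk : k = i ∨ k = j
        · rw [if_pos hk]
          rcases hk with rfl | rfl
          exacts [h1, h2]
        · simp [hk]
      · exact fun h => ⟨by simpa using h i, by simpa using h j⟩
    rw [this, Measure.pi_pi, ← Finset.prod_subset (Finset.subset_univ {i, j}),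
      Finset.prod_pair hij]
    · simp
    · intro k _ hk
      simp only [Finset.mem_insert, Finset.mem_singleton] at hk
      simp [hk]
  obtain ⟨C, hC⟩ := (hμ i).exists_mul_tail_le
  obtain ⟨D, hD⟩ := (hμ j).exists_mul_tail_le
  simp_rw [htail]
  rw [← Set.Ioc_union_Ioi_eq_Ioi (zero_le_one (α := ℝ)),
    lintegral_union measurableSet_Ioi (Set.Ioc_disjoint_Ioi le_rfl), ENNReal.add_lt_top]
  constructor
  · refine lt_of_le_of_lt (lintegral_mono (g := fun _ => 1) fun t => ?_) (by simp)
    exact mul_le_one' prob_le_one prob_le_one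
  · have hint : IntegrableOn (fun t : ℝ => C * D * t ^ (-2 : ℝ)) (Set.Ioi 1) :=
      (integrableOn_Ioi_rpow_of_lt (by norm_num) zero_lt_one).const_mul _
    refine lt_of_le_of_lt (setLIntegral_mono' measurableSet_Ioi fun t ht => ?_)
      hint.lintegral_lt_top
    have ht : 1 < t := ht
    have ht0 : 0 < t := by linarith
    rw [← ofReal_measureReal, ← ofReal_measureReal, ← ENNReal.ofReal_mul measureReal_nonneg]
    refine ENNReal.ofReal_le_ofReal ?_
    rw [Real.rpow_neg ht0.le, Real.rpow_two, ← div_eq_mul_inv, le_div_iff₀ (by positivity)]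
    have h1 := mul_le_mul (hC t) (hD t) (mul_nonneg ht0.le measureReal_nonneg)
      ((mul_nonneg ht0.le measureReal_nonneg).trans (hC t))
    linarith

lemma hasExpectedPayments {μ : Fin n → Measure ℝ} (hμ : ∀ i, IsRegularDistribution (μ i)) :
    (auction n).HasExpectedPayments μ := by
  have hprob : ∀ i, IsProbabilityMeasure (μ i) := fun i => (hμ i).1
  intro i
  refine Integrable.mono' (integrable_finsetSum (Finset.univ.erase i) fun j hj =>
    integrable_min hμ (Finset.ne_of_mem_erase hj).symm)
    ((auction n).measurable_pay i).aestronglyMeasurable ?_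
  filter_upwards [ae_pi_nonneg fun i => (hμ i).2.1] with v hv
  rw [Real.norm_of_nonneg (pay_nonneg v i)]
  exact pay_le hv i

/-- With `W` the sum over the bidders of the best revenues from posted prices of at least `τ`, the
second price auction earns at least `W τ / (W + 3 τ)`: at each level `t ≤ τ`, two bids of at least
`t` have probability at least `(S / (S + t))²`, where `S = W / 3`. -/
lemma le_revenue {μ : Fin n → Measure ℝ} (hμ : ∀ i, IsRegularDistribution (μ i))
    (htwin : ∀ i, ∃ j, j ≠ i ∧ μ j = μ i) {τ : ℝ} (hτ : 0 < τ)
    (hW : 0 < ∑ i, postedPriceRevenue (μ i) τ) :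
    (∑ i, postedPriceRevenue (μ i) τ) * τ / ((∑ i, postedPriceRevenue (μ i) τ) + 3 * τ) ≤
      (auction n).revenue μ := by
  have hprob : ∀ i, IsProbabilityMeasure (μ i) := fun i => (hμ i).1
  set w := fun i => postedPriceRevenue (μ i) τ with hw
  have hw0 : ∀ i, 0 ≤ w i := fun i => (hμ i).postedPriceRevenue_nonneg hτ.le
  obtain ⟨A, hA, hA'⟩ := exists_third_le_sum hw0 fun i => by
    obtain ⟨j, hj, hji⟩ := htwin i
    exact ⟨j, hj, by rw [hw]; simp only [hji]⟩
  set S := (∑ i, w i) / 3 with hS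
  have hS0 : 0 < S := by rw [hS]; linarith
  have hint : Integrable (fun v => ∑ i, (auction n).pay v i) (Measure.pi μ) :=
    integrable_finsetSum _ fun i _ => hasExpectedPayments hμ i
  have hnn : 0 ≤ fun v => ∑ i, (auction n).pay v i :=
    fun v => Finset.sum_nonneg fun i _ => pay_nonneg v i
  set g := fun t => (Measure.pi μ).real {v | t ≤ ∑ i, (auction n).pay v i} with hg
  have hgmono : Antitone g := fun s t hst => measureReal_mono fun v hv => hst.trans hv
  have hlayer : ∫ t in Set.Ioc 0 τ, g t ≤ (auction n).revenue μ := by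
    rw [Auction.revenue, integral_eq_lintegral_of_nonneg_ae (ae_of_all _ hnn) hint.1,
      lintegral_eq_lintegral_meas_le _ (ae_of_all _ hnn) hint.aemeasurable,
      integral_eq_lintegral_of_nonneg_ae (ae_of_all _ fun t => measureReal_nonneg)
        hgmono.measurable.aestronglyMeasurable]
    refine ENNReal.toReal_mono ?_ ?_
    · rw [← lintegral_eq_lintegral_meas_le _ (ae_of_all _ hnn) hint.aemeasurable]
      exact hint.lintegral_lt_top.ne
    · exact le_of_eq_of_le (lintegral_congr fun t => ofReal_measureReal)
        (lintegral_mono_set Set.Ioc_subset_Ioi_self)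
  refine le_trans ?_ hlayer
  have hlow : ∀ t ∈ Set.Ioc 0 τ, (S / (S + t)) ^ 2 ≤ g t := by
    intro t ht
    have hF : ∀ i, (μ i).real (Set.Iio t) = 1 - (μ i).real (Set.Ici t) := fun i => by
      rw [← Set.compl_Ici, probReal_compl_eq_one_sub measurableSet_Ici]
    have hside : ∀ s : Finset (Fin n), S ≤ ∑ i ∈ s, w i →
        S / (S + t) ≤ 1 - ∏ i ∈ s, (μ i).real (Set.Iio t) := fun s hs =>
      div_add_le_one_sub ht.1 hS0.le hs (prod_mul_add_sum_le ht.1 s (fun i _ => hw0 i)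
        (fun i _ => measureReal_nonneg) fun i _ => by
          rw [hF]; exact (hμ i).tail_bound ht.1 ht.2)
    have hpos : 0 ≤ S / (S + t) := div_nonneg hS0.le (by linarith [ht.1])
    rw [sq]
    refine (mul_le_mul (hside A hA) (hside Aᶜ hA') hpos (hpos.trans (hside A hA))).trans ?_
    exact (measureReal_two_le A).trans (measureReal_mono fun v hv => le_sum_pay hv)
  have hcont : ContinuousOn (fun t : ℝ => (S / (S + t)) ^ 2) (Set.Icc 0 τ) :=
    (continuousOn_const.div (by fun_prop) fun t ht => by linarith [ht.1]).pow 2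
  have hgint : IntegrableOn g (Set.Icc 0 τ) :=
    hgmono.locallyIntegrable.integrableOn_isCompact isCompact_Icc
  have h1 := setIntegral_mono_on (hcont.integrableOn_Icc.mono_set Set.Ioc_subset_Icc_self)
    (hgint.mono_set Set.Ioc_subset_Icc_self) measurableSet_Ioc hlow
  rw [← intervalIntegral.integral_of_le hτ.le, integral_sq_div_add hS0 hτ.le] at h1
  refine le_trans (le_of_eq ?_) h1
  rw [hS]
  field_simp

end SecondPrice

theorem corollary4p3 :
    ∃ α : ℝ, 1 / 8 < α ∧
      ∀ n : ℕ, 0 < n →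
        ∃ A : Auction n, A.IsIndividuallyRational ∧ A.IsDominantStrategyIC ∧
          ∀ μ : Fin n → Measure ℝ,
            (∀ i, IsRegularDistribution (μ i)) →
            (∀ i, ∃ j, j ≠ i ∧ μ j = μ i) →
              A.HasExpectedPayments μ ∧
              BddAbove (attainableRevenues μ) ∧
              α * optimalRevenue μ ≤ A.revenue μ ∧
              1 / 8 * optimalRevenue μ < A.revenue μ := by
  refine ⟨2 / 15, by norm_num, fun n hn => ⟨SecondPrice.auction n,
    SecondPrice.isIndividuallyRational, SecondPrice.isDominantStrategyIC, fun μ hμ htwin => ?_⟩⟩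
  have hub : ∀ τ, 0 ≤ τ → ∀ r ∈ attainableRevenues μ,
      r ≤ τ + ∑ i, postedPriceRevenue (μ i) τ := by
    rintro τ hτ _ ⟨B, hIR, hIC, hP, rfl⟩
    exact B.revenue_le hμ hIR hIC hP hτ
  have hbdd : BddAbove (attainableRevenues μ) := ⟨_, hub 1 zero_le_one⟩
  have hpos : 0 < (SecondPrice.auction n).revenue μ := by
    obtain ⟨τ, hτ, hr⟩ := (hμ ⟨0, hn⟩).exists_postedPriceRevenue_pos
    have hW : 0 < ∑ i, postedPriceRevenue (μ i) τ :=
      hr.trans_le (Finset.single_le_sum (f := fun i => postedPriceRevenue (μ i) τ)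
        (fun i _ => (hμ i).postedPriceRevenue_nonneg hτ.le) (Finset.mem_univ _))
    exact lt_of_lt_of_le (by positivity) (SecondPrice.le_revenue hμ htwin hτ hW)
  refine ⟨SecondPrice.hasExpectedPayments hμ, hbdd, ?_⟩
  rcases le_or_gt (optimalRevenue μ) 0 with hopt | hopt
  · constructor <;> linarith
  have hmain : 2 / 15 * optimalRevenue μ ≤ (SecondPrice.auction n).revenue μ := by
    -- the level `τ = OPT / 3` leaves posted prices above `τ` a revenue of at least `2 OPT / 3`
    have hτ : 0 < optimalRevenue μ / 3 := by positivity
    set W := ∑ i, postedPriceRevenue (μ i) (optimalRevenue μ / 3) with hW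
    have hne : (attainableRevenues μ).Nonempty := by
      by_contra! h
      rw [optimalRevenue, h, Real.sSup_empty] at hopt
      exact lt_irrefl _ hopt
    have h1 : optimalRevenue μ ≤ optimalRevenue μ / 3 + W := csSup_le hne (hub _ hτ.le)
    have hW0 : 0 < W := by linarith
    refine le_trans ?_ (SecondPrice.le_revenue hμ htwin hτ hW0)
    rw [← hW, le_div_iff₀ (by positivity)]
    nlinarith
  exact ⟨hmain, by linarith⟩
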